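/- Let $\Xi=\Xi_1\times\dots\times\Xi_N$ be a finite set of scenarios $\xi=(\xi_1,\dots,\xi_N)$ with probabilities $p(\xi)>0$, $\sum_\xi p(\xi)=1$, let $n=n_1+\dots+n_N$, and let $\mathcal L_n$ be the Hilbert space of all maps $x(\cdot):\Xi\to\mathbb R^n$, $x(\xi)=(x_1(\xi),\dots,x_N(\xi))$ with $x_k(\xi)\in\mathbb R^{n_k}$, with inner product $\langle x(\cdot),w(\cdot)\rangle=\sum_{\xi}p(\xi)\langle x(\xi),w(\xi)\rangle$. Let $$\mathcal N_n=\{x(\cdot): x_k(\xi)\text{ does not depend on }\xi_k,\dots,\xi_N,\ k=1,\dots,N\},$$ $$\mathcal M_n=\{w(\cdot): E[w_k(\xi)\mid\xi_1,\dots,\xi_{k-1}]=0,\ k=1,\dots,N\}=\mathcal N_n^{\perp}.$$ Let $C(\xi)\subset\mathbb R^n$ be nonempty, closed and convex for every $\xi$, let $\mathcal C=\{x(\cdot):x(\xi)\in C(\xi)\ \forall\xi\}$, and let $\mathcal F(x(\cdot)):\xi\mapsto F(x(\xi),\xi)$. Let $J$ be the number of scenarios, $\bar n=nJ$, and let $\phi:\mathcal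 L_n\to\mathbb R^{\bar n}$ be the linear isometry whose block at the scenario $\xi$ is $\sqrt{p(\xi)}\,x(\xi)$. Let $\hat F$ be the map on $\mathbb R^{\bar n}$ whose block at $\xi$ is $\sqrt{p(\xi)}\,F\big(x_\xi/\sqrt{p(\xi)},\xi\big)$, where $x_\xi$ is the block of $x$ at $\xi$; thus $\phi\circ\mathcal F=\hat F\circ\phi$. Suppose that $\mathcal F$ is continuously differentiable on $\mathcal C$ and pseudomonotone on $\mathcal C$, i.e. for all $x,y\in\mathcal C$, $\langle y-x,\mathcal F(x)\rangle\ge0$ implies $\langle y-x,\mathcal F(y)\rangle\ge0$. For $x\in\phi(\mathcal C)$ let $D\hat F(x)$ be the Jacobian of $\hat F$ at $x$ (relative to $\phi(\mathcal C)$). Suppose that there is a function $\alpha\ge0$ on $\phi(\mathcal C)$ such that for every $x\in\phi(\mathcal C)$ $$\langle y,D\hat F(x)y\rangle\ge\alpha(x)\|y\|^2\qquad\text{for all }y\in\phi(\mathcal N_n).$$ With $P_V$ the orthogonal projector onto a subspace $V$ and operator norms, set $$\beta(x)=\tfrac12\big\|P_{\phi(\mathcal N_n)}\big(D\hat F(x)+D\hat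 F(x)^T\big)P_{\phi(\mathcal M_n)}\big\|,\qquad \gamma(x)=\big\|P_{\phi(\mathcal M_n)}D\hat F(x)P_{\phi(\mathcal M_n)}\big\|,$$ $$e_0=\sup_{x\in\phi(\mathcal C)}\Big\{\frac{\beta(x)^2}{\alpha(x)}+\gamma(x)\Big\}\in[0,\infty],$$ where $0/0=0$ and $b/0=\infty$ for $b>0$. If $e_0<\infty$, then the monotonicity of $\mathcal F+N_{\mathcal C}$ is globally elicited at every level $s>e_0$: the set-valued map $\mathcal F+N_{\mathcal C}+sP_{\mathcal M_n}$ on $\mathcal L_n$ is maximal monotone. Here $N_{\mathcal C}(x)=\{v:\langle v,y-x\rangle\le0\ \forall y\in\mathcal C\}$ for $x\in\mathcal C$, and $N_{\mathcal C}(x)=\emptyset$ for $x\notin\mathcal C$. -/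

import Mathlib

open scoped BigOperators InnerProductSpace

noncomputable section

namespace MultistageSVI

/-! ### Monotone set-valued mappings on a real Hilbert space -/

section Abstract

variable {H : Type*} [NormedAddCommGroup H] [InnerProductSpace ℝ H]

/-- `T : H ⇉ H` is monotone. -/
def IsMonotoneMap (T : H → Set H) : Prop :=
  ∀ x y : H, ∀ u ∈ T x, ∀ v ∈ T y, 0 ≤ ⟪u - v, x - y⟫_ℝ

/-- `T : H ⇉ H` is maximal monotone: it is monotone, and every pair outside its graph violates
monotonicity against some pair of the graph. -/
def IsMaximalMonotone (T : H → Set H) : Prop :=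
  IsMonotoneMap T ∧
    ∀ x' y' : H, y' ∉ T x' → ∃ x y : H, y ∈ T x ∧ ⟪y' - y, x' - x⟫_ℝ < 0

/-- The normal cone `N_C(x)` of a set `C` at `x`; it is empty when `x ∉ C`. -/
def normalCone (C : Set H) (x : H) : Set H :=
  {v | x ∈ C ∧ ∀ y ∈ C, ⟪v, y - x⟫_ℝ ≤ 0}

/-- `G` is pseudomonotone on `K`. -/
def PseudomonotoneOn (G : H → H) (K : Set H) : Prop :=
  ∀ x ∈ K, ∀ y ∈ K, 0 ≤ ⟪y - x, G x⟫_ℝ → 0 ≤ ⟪y - x, G y⟫_ℝ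

/-- The set-valued mapping `G + N_C + s P_M`, with `P_M` the orthogonal projector onto `M`. -/
def elicitedMap (G : H → H) (C : Set H) (M : Submodule ℝ H) [M.HasOrthogonalProjection]
    (s : ℝ) (x : H) : Set H :=
  {y | ∃ v ∈ normalCone C x, y = G x + v + s • M.starProjection x}

/-- The monotonicity of `G + N_C` is globally elicited at level `s > 0`, where `M` is the
orthogonal complement of the linkage subspace. -/
def GloballyElicitedAt (G : H → H) (C : Set H) (M : Submodule ℝ H) [M.HasOrthogonalProjection]
    (s : ℝ) : Prop :=
  0 < s ∧ IsMaximalMonotone (elicitedMap G C M s)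

end Abstract

/-! ### Scenarios and the Hilbert space `𝓛ₙ` -/

/-- The scenarios `ξ = (ξ₁, …, ξ_N) ∈ Ξ₁ × ⋯ × Ξ_N`. -/
abbrev Scenario {N : ℕ} (Ξ : Fin N → Type*) : Type _ := ∀ k, Ξ k

/-- The space `ℝⁿ`, `n = n₁ + ⋯ + n_N`: coordinate `⟨k, i⟩` of `x` is the `i`-th coordinate of
the `k`-th stage component `x_k ∈ ℝ^{n_k}`. -/
abbrev Decision {N : ℕ} (n : Fin N → ℕ) : Type := EuclideanSpace ℝ (Σ k, Fin (n k))

variable {N : ℕ} {Ξ : Fin N → Type*} [∀ k, Fintype (Ξ k)]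

/-- A probability distribution on the scenarios in which every scenario has positive
probability. -/
structure ScenarioLaw {N : ℕ} (Ξ : Fin N → Type*) [∀ k, Fintype (Ξ k)] where
  /-- the probability of a scenario -/
  prob : Scenario Ξ → ℝ
  prob_pos : ∀ ξ, 0 < prob ξ
  prob_sum : ∑ ξ, prob ξ = 1

/-- The space `𝓛ₙ` of all mappings from the scenarios to `ℝⁿ`; the law `P` enters through its
inner product. -/
def LSpace (_P : ScenarioLaw Ξ) (n : Fin N → ℕ) : Type _ := Scenario Ξ → Decision n

variable (P : ScenarioLaw Ξ) (n : Fin N → ℕ)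

instance : AddCommGroup (LSpace P n) := inferInstanceAs (AddCommGroup (Scenario Ξ → Decision n))

instance : Module ℝ (LSpace P n) := inferInstanceAs (Module ℝ (Scenario Ξ → Decision n))

instance : FiniteDimensional ℝ (LSpace P n) :=
  inferInstanceAs (FiniteDimensional ℝ (Scenario Ξ → Decision n))

/-- The inner product `⟨x, w⟩ = ∑_ξ p(ξ) ⟨x(ξ), w(ξ)⟩` of `𝓛ₙ`. -/
@[reducible] def LSpace.innerCore : InnerProductSpace.Core ℝ (LSpace P n) where
  inner x w := ∑ ξ, P.prob ξ * ⟪x ξ, w ξ⟫_ℝ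
  conj_inner_symm x w := by
    simp only [conj_trivial]
    exact Finset.sum_congr rfl fun ξ _ => by rw [real_inner_comm]
  re_inner_nonneg x := by
    simp only [RCLike.re_to_real]
    exact Finset.sum_nonneg fun ξ _ => mul_nonneg (P.prob_pos ξ).le real_inner_self_nonneg
  add_left x y w := by
    rw [← Finset.sum_add_distrib]
    refine Finset.sum_congr rfl fun ξ _ => ?_
    rw [← mul_add, ← inner_add_left]
    rfl
  smul_left x w r := by
    rw [Finset.mul_sum]
    refine Finset.sum_congr rfl fun ξ _ => ?_
    have h : ((r • x : LSpace P n) ξ) = r • x ξ := rfl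
    rw [h, real_inner_smul_left]
    simp only [conj_trivial]
    ring
  definite x hx := by
    have h := (Finset.sum_eq_zero_iff_of_nonneg fun ξ _ =>
      mul_nonneg (P.prob_pos ξ).le (real_inner_self_nonneg (x := x ξ))).1 hx
    funext ξ
    have h1 := h ξ (Finset.mem_univ ξ)
    rcases mul_eq_zero.1 h1 with h2 | h2
    · exact absurd h2 (P.prob_pos ξ).ne'
    · exact inner_self_eq_zero.1 h2

instance : NormedAddCommGroup (LSpace P n) :=
  (LSpace.innerCore P n).toNormedAddCommGroup

instance : InnerProductSpace ℝ (LSpace P n) :=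
  InnerProductSpace.ofCore (LSpace.innerCore P n).toCore

/-! ### Nonanticipativity -/

/-- The nonanticipativity subspace `𝓝ₙ`: the `k`-th stage component `x_k(ξ)` does not depend on
`ξ_k, …, ξ_N`. -/
def nonanticipative : Submodule ℝ (LSpace P n) where
  carrier := {x | ∀ (k : Fin N) (ξ ξ' : Scenario Ξ), (∀ j < k, ξ j = ξ' j) →
    ∀ i : Fin (n k), x ξ ⟨k, i⟩ = x ξ' ⟨k, i⟩}
  zero_mem' := fun _ _ _ _ _ => rfl
  add_mem' := fun hx hy k ξ ξ' h i =>
    congrArg₂ (· + ·) (hx k ξ ξ' h i) (hy k ξ ξ' h i)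
  smul_mem' := fun r _ hx k ξ ξ' h i => congrArg (r * ·) (hx k ξ ξ' h i)

open Classical in
/-- The conditional expectation `E[f ∣ ξ₁, …, ξ_{k-1}]` of a real function of the scenario, at the
scenario `ξ`. -/
def condExpBefore (k : Fin N) (f : Scenario Ξ → ℝ) (ξ : Scenario Ξ) : ℝ :=
  (∑ ξ' with ∀ j < k, ξ' j = ξ j, P.prob ξ' * f ξ') / ∑ ξ' with ∀ j < k, ξ' j = ξ j, P.prob ξ'

/-- The subspace `𝓜ₙ` of all `w` with `E[w_k ∣ ξ₁, …, ξ_{k-1}] = 0` for every stage `k`; it is the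
orthogonal complement of `𝓝ₙ`. -/
def multiplierSpace : Submodule ℝ (LSpace P n) where
  carrier := {w | ∀ (k : Fin N) (i : Fin (n k)) (ξ : Scenario Ξ),
    condExpBefore P k (fun ξ' => w ξ' ⟨k, i⟩) ξ = 0}
  zero_mem' := fun k i ξ => by
    have h : ∀ ξ' : Scenario Ξ, (0 : LSpace P n) ξ' ⟨k, i⟩ = 0 := fun _ => rfl
    simp [condExpBefore, h]
  add_mem' := fun {x y} hx hy k i ξ => by
    have h : ∀ ξ' : Scenario Ξ, (x + y : LSpace P n) ξ' ⟨k, i⟩ = x ξ' ⟨k, i⟩ + y ξ' ⟨k, i⟩ :=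
      fun _ => rfl
    have hx' := hx k i ξ
    have hy' := hy k i ξ
    simp only [condExpBefore] at hx' hy' ⊢
    simp only [h, mul_add, Finset.sum_add_distrib, add_div, hx', hy', add_zero]
  smul_mem' := fun r x hx k i ξ => by
    have h : ∀ ξ' : Scenario Ξ, (r • x : LSpace P n) ξ' ⟨k, i⟩ = r * x ξ' ⟨k, i⟩ := fun _ => rfl
    have hx' := hx k i ξ
    simp only [condExpBefore] at hx' ⊢
    simp only [h, mul_left_comm _ r, ← Finset.mul_sum, mul_div_assoc, hx', mul_zero]

/-! ### Data of the stochastic variational inequality -/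

variable {n}

/-- The constraint set `𝓒 = {x : x(ξ) ∈ C(ξ) for all ξ}`. -/
def constraintSet (C : Scenario Ξ → Set (Decision n)) : Set (LSpace P n) :=
  {x | ∀ ξ, x ξ ∈ C ξ}

/-- The mapping `𝓕(x) : ξ ↦ F(x(ξ), ξ)`. -/
def svMap (F : Decision n → Scenario Ξ → Decision n) (x : LSpace P n) : LSpace P n :=
  fun ξ => F (x ξ) ξ

/-! ### The isometry `φ` onto `ℝ^{n̄}` -/

/-- The Euclidean space `ℝ^{n̄}`, `n̄ = n J` with `J` the number of scenarios, its coordinates being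
indexed by a scenario and a coordinate of `ℝⁿ`. -/
abbrev Stacked {N : ℕ} (Ξ : Fin N → Type*) [∀ k, Fintype (Ξ k)] (n : Fin N → ℕ) : Type _ :=
  EuclideanSpace ℝ (Scenario Ξ × (Σ k, Fin (n k)))

/-- The block of `x ∈ ℝ^{n̄}` that belongs to the scenario `ξ`. -/
def block (x : Stacked Ξ n) (ξ : Scenario Ξ) : Decision n :=
  WithLp.toLp 2 fun c => x (ξ, c)

variable (n)

/-- The linear isometric isomorphism `φ : 𝓛ₙ → ℝ^{n̄}` whose block at `ξ` is `√p(ξ) x(ξ)`. -/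
def phi : LSpace P n ≃ₗᵢ[ℝ] Stacked Ξ n where
  toFun x := WithLp.toLp 2 fun c => √(P.prob c.1) * x c.1 c.2
  invFun y := fun ξ => (√(P.prob ξ))⁻¹ • block y ξ
  map_add' x y := by
    ext c
    exact mul_add _ _ _
  map_smul' r x := by
    ext c
    exact mul_left_comm _ _ _
  left_inv x := by
    funext ξ
    ext c
    exact inv_mul_cancel_left₀ (Real.sqrt_pos.2 (P.prob_pos ξ)).ne' _
  right_inv y := by
    ext c
    exact mul_inv_cancel_left₀ (Real.sqrt_pos.2 (P.prob_pos c.1)).ne' _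
  norm_map' x := by
    rw [← sq_eq_sq₀ (norm_nonneg _) (norm_nonneg _), ← real_inner_self_eq_norm_sq x,
      EuclideanSpace.norm_sq_eq, Fintype.sum_prod_type]
    refine Finset.sum_congr rfl fun ξ _ => ?_
    rw [real_inner_self_eq_norm_sq, EuclideanSpace.norm_sq_eq, Finset.mul_sum]
    refine Finset.sum_congr rfl fun c _ => ?_
    change ‖√(P.prob ξ) * x ξ c‖ ^ 2 = P.prob ξ * ‖x ξ c‖ ^ 2
    rw [norm_mul, mul_pow, Real.norm_eq_abs, sq_abs, Real.sq_sqrt (P.prob_pos ξ).le]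

variable {n}

/-- The mapping `F̂` on `ℝ^{n̄}` whose block at `ξ` is `√p(ξ) F(x_ξ / √p(ξ), ξ)`, with `x_ξ` the
block of `x` at `ξ`. -/
def hatMap (F : Decision n → Scenario Ξ → Decision n) (x : Stacked Ξ n) : Stacked Ξ n :=
  WithLp.toLp 2 fun c =>
    √(P.prob c.1) * F ((1 / √(P.prob c.1)) • block x c.1) c.1 c.2

/-! ### The quantities in the criterion -/

/-- The subspace `φ(𝓝ₙ)` of `ℝ^{n̄}`. -/
abbrev phiN (n : Fin N → ℕ) : Submodule ℝ (Stacked Ξ n) :=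
  (nonanticipative P n).map (phi P n).toLinearEquiv.toLinearMap

/-- The subspace `φ(𝓜ₙ)` of `ℝ^{n̄}`. -/
abbrev phiM (n : Fin N → ℕ) : Submodule ℝ (Stacked Ξ n) :=
  (multiplierSpace P n).map (phi P n).toLinearEquiv.toLinearMap

/-- `β = ½ ‖P_{φ(𝓝ₙ)} (A + Aᵀ) P_{φ(𝓜ₙ)}‖` (operator norm) for a Jacobian `A`. -/
def beta (A : Stacked Ξ n →L[ℝ] Stacked Ξ n) : ℝ :=
  1 / 2 * ‖(phiN P n).starProjection ∘L (A + ContinuousLinearMap.adjoint A) ∘L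
    (phiM P n).starProjection‖

/-- `γ = ‖P_{φ(𝓜ₙ)} A P_{φ(𝓜ₙ)}‖` (operator norm) for a Jacobian `A`. -/
def gamma (A : Stacked Ξ n →L[ℝ] Stacked Ξ n) : ℝ :=
  ‖(phiM P n).starProjection ∘L A ∘L (phiM P n).starProjection‖

/-- `e₀ = sup_{x ∈ K} (β(x)² / α(x) + γ(x)) ∈ [0, ∞]` for a Jacobian field `D` on `K` and
`α ≥ 0`, with `0 / 0 = 0` and `b / 0 = ∞` for `b > 0`. -/
def elicitationBound (D : Stacked Ξ n → Stacked Ξ n →L[ℝ] Stacked Ξ n) (α : Stacked Ξ n → ℝ)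
    (K : Set (Stacked Ξ n)) : ENNReal :=
  ⨆ x ∈ K, (ENNReal.ofReal (beta P (D x) ^ 2) / ENNReal.ofReal (α x) +
    ENNReal.ofReal (gamma P (D x)))

end MultistageSVI

end

open scoped InnerProductSpace

/-! Write an increment as `d = u + w` with `w = P_M d` and `u` in `Mᗮ ⊆ N`. For a Jacobian `A`, read
through the isometry `φ`, `⟪d, A d⟫ ≥ α‖u‖² - 2β‖u‖‖w‖ - γ‖w‖²`. Since `s > β²/α + γ`, adding
`s‖w‖²` makes the right side nonnegative by completing the square (`neg_mul_norm_sq_le_inner`). The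
mean value theorem on segments of the convex set turns this into monotonicity of `𝓕 + s P_M` on `𝓒`.

Maximality is Minty's argument (`isMaximalMonotone_elicitedMap`): with `T` the elicited map, `x' +
y' ∈ z + T z` is solvable for all `x'`, `y'`. It amounts to a strongly monotone variational
inequality on `𝓒`, solved by a projected contraction after cutting `𝓒` down to a compact set, where
the C¹ map is Lipschitz. -/

namespace MultistageSVI

/-! ### Strongly monotone variational inequalities and maximality -/

section VariationalInequality

variable {H : Type*} [NormedAddCommGroup H] [InnerProductSpace ℝ H]

/-- A strongly monotone Lipschitz variational inequality on a complete convex set is solvable. -/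
theorem exists_variationalInequality_of_lipschitzOnWith {K : Set H} (hne : K.Nonempty)
    (hcomp : IsComplete K) (hconv : Convex ℝ K) {B : H → H} {L : NNReal}
    (hL : LipschitzOnWith L B K)
    (hB : ∀ x ∈ K, ∀ y ∈ K, ‖x - y‖ ^ 2 ≤ ⟪B x - B y, x - y⟫_ℝ) :
    ∃ z ∈ K, ∀ y ∈ K, 0 ≤ ⟪B z, y - z⟫_ℝ := by
  have hproj : ∀ u : H, ∃ v ∈ K, ∀ w ∈ K, ⟪u - v, w - v⟫_ℝ ≤ 0 := fun u => by
    obtain ⟨v, hv, h⟩ := exists_norm_eq_iInf_of_complete_convex hne hcomp hconv u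
    exact ⟨v, hv, (norm_eq_iInf_iff_real_inner_le_zero hconv hv).1 h⟩
  choose p hpK hp using hproj
  have hp1 : ∀ u v, ‖p u - p v‖ ≤ ‖u - v‖ := fun u v => by
    have h1 := hp u (p v) (hpK v)
    have h2 := hp v (p u) (hpK u)
    have h3 : ‖p u - p v‖ ^ 2 ≤ ⟪u - v, p u - p v⟫_ℝ := by
      rw [← real_inner_self_eq_norm_sq]
      simp only [inner_sub_left, inner_sub_right] at h1 h2 ⊢
      linarith [real_inner_comm (p u) (p v)]
    have h4 := real_inner_le_norm (u - v) (p u - p v)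
    rcases (norm_nonneg (p u - p v)).eq_or_lt with h | h
    · rw [← h]; exact norm_nonneg _
    · nlinarith
  set l : ℝ := L + 1 with hl
  have hl1 : 1 ≤ l := by simp [hl]
  have hLl : ∀ x ∈ K, ∀ y ∈ K, ‖B x - B y‖ ≤ l * ‖x - y‖ := fun x hx y hy => by
    have h := hL.dist_le_mul x hx y hy
    rw [dist_eq_norm, dist_eq_norm] at h
    nlinarith [norm_nonneg (x - y)]
  -- With strong monotonicity modulus 1, the step `x - r • B x` scales squared distances by at most
  -- `1 - 2r + r²l² = 1 - r`.
  set r : ℝ := 1 / l ^ 2 with hr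
  have hrpos : 0 < r := by positivity
  have hrl : r * l ^ 2 = 1 := by rw [hr]; field_simp
  have hr1 : r ≤ 1 := by rw [hr, div_le_one (by positivity)]; exact one_le_pow₀ hl1
  let k : NNReal := ⟨√(1 - r), Real.sqrt_nonneg _⟩
  have hk1 : k < 1 := by
    change √(1 - r) < 1
    rw [Real.sqrt_lt' one_pos]
    linarith
  let f : K → K := fun x => ⟨p (x - r • B x), hpK _⟩
  have hf : ContractingWith k f := by
    refine ⟨hk1, LipschitzWith.of_dist_le_mul fun x y => ?_⟩
    rw [Subtype.dist_eq, Subtype.dist_eq, dist_eq_norm, dist_eq_norm]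
    refine (hp1 _ _).trans ?_
    change _ ≤ √(1 - r) * _
    refine le_of_sq_le_sq ?_ (by positivity)
    rw [mul_pow, Real.sq_sqrt (by linarith)]
    have e : (x : H) - r • B x - (y - r • B y) = (x - y : H) - r • (B x - B y) := by
      rw [smul_sub]; abel
    rw [e, norm_sub_sq_real, norm_smul, real_inner_smul_right, real_inner_comm,
      Real.norm_eq_abs, mul_pow, sq_abs]
    have h1 := hB x x.2 y y.2
    have h2 : ‖B x - B y‖ ^ 2 ≤ l ^ 2 * ‖(x : H) - y‖ ^ 2 := by
      rw [← mul_pow]; exact pow_le_pow_left₀ (norm_nonneg _) (hLl x x.2 y y.2) 2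
    have h3 : r ^ 2 * ‖B x - B y‖ ^ 2 ≤ r * ‖(x : H) - y‖ ^ 2 :=
      calc r ^ 2 * ‖B x - B y‖ ^ 2 ≤ r ^ 2 * (l ^ 2 * ‖(x : H) - y‖ ^ 2) := by gcongr
        _ = r * (r * l ^ 2) * ‖(x : H) - y‖ ^ 2 := by ring
        _ = r * ‖(x : H) - y‖ ^ 2 := by rw [hrl, mul_one]
    nlinarith [mul_le_mul_of_nonneg_left h1 hrpos.le]
  have : CompleteSpace K := hcomp.completeSpace_coe
  have : Nonempty K := hne.to_subtype
  have hz : p (hf.fixedPoint - r • B hf.fixedPoint) = hf.fixedPoint :=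
    congrArg Subtype.val hf.fixedPoint_isFixedPt
  -- The obtuse-angle inequality for the projection at the fixed point is `r` times the variational
  -- inequality.
  refine ⟨hf.fixedPoint, hf.fixedPoint.2, fun y hy => ?_⟩
  have h := hp (hf.fixedPoint - r • B hf.fixedPoint) y hy
  rw [hz, sub_sub_cancel_left, inner_neg_left, real_inner_smul_left] at h
  exact nonneg_of_mul_nonneg_right (by linarith) hrpos

/-- A strongly monotone, locally Lipschitz variational inequality on a closed convex set of a
finite-dimensional space is solvable. -/
theorem exists_variationalInequality [FiniteDimensional ℝ H] {C : Set H} (hne : C.Nonempty)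
    (hcl : IsClosed C) (hconv : Convex ℝ C) {B : H → H} (hL : LocallyLipschitzOn C B)
    (hB : ∀ x ∈ C, ∀ y ∈ C, ‖x - y‖ ^ 2 ≤ ⟪B x - B y, x - y⟫_ℝ) :
    ∃ z ∈ C, ∀ y ∈ C, 0 ≤ ⟪B z, y - z⟫_ℝ := by
  obtain ⟨x₀, hx₀⟩ := hne
  have : ProperSpace H := FiniteDimensional.proper_real H
  -- Strong monotonicity against `x₀` forces `‖z - x₀‖ ≤ ‖B x₀‖`, so this radius keeps the solution
  -- strictly inside the ball.
  set R : ℝ := ‖B x₀‖ + 1 with hR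
  have hKC : C ∩ Metric.closedBall x₀ R ⊆ C := Set.inter_subset_left
  have hcpt : IsCompact (C ∩ Metric.closedBall x₀ R) :=
    (isCompact_closedBall x₀ R).inter_left hcl
  have hx₀K : x₀ ∈ C ∩ Metric.closedBall x₀ R :=
    ⟨hx₀, Metric.mem_closedBall_self (by positivity)⟩
  obtain ⟨L, hLip⟩ := (hL.mono hKC).exists_lipschitzOnWith_of_compact hcpt
  obtain ⟨z, hz, hzK⟩ := exists_variationalInequality_of_lipschitzOnWith ⟨x₀, hx₀K⟩
    hcpt.isComplete (hconv.inter (convex_closedBall x₀ R)) hLip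
    fun x hx y hy => hB x (hKC hx) y (hKC hy)
  have hbound : ‖z - x₀‖ < R := by
    have h1 := hB z hz.1 x₀ hx₀
    have h2 := hzK x₀ hx₀K
    rw [← neg_sub z x₀, inner_neg_right] at h2
    rw [inner_sub_left] at h1
    have h3 := neg_le_of_abs_le (abs_real_inner_le_norm (B x₀) (z - x₀))
    rcases (norm_nonneg (z - x₀)).eq_or_lt with h | h
    · rw [← h]; positivity
    · nlinarith
  refine ⟨z, hz.1, fun y hy => ?_⟩
  -- The ball is inactive at `z`: a step this short towards `y` stays inside it. The extra `R` in
  -- the denominator covers `y = z` and gives `t ≤ 1`.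
  set t : ℝ := (R - ‖z - x₀‖) / (R + ‖y - z‖) with ht
  have hRpos : 0 < R := by positivity
  have htpos : 0 < t := div_pos (by linarith) (by positivity)
  have ht1 : t ≤ 1 := by
    rw [ht, div_le_one (by positivity)]
    linarith [norm_nonneg (y - z), norm_nonneg (z - x₀)]
  have hty : t * ‖y - z‖ ≤ R - ‖z - x₀‖ := by
    have h : t * (R + ‖y - z‖) = R - ‖z - x₀‖ := div_mul_cancel₀ _ (by positivity)
    nlinarith
  have hmem : z + t • (y - z) ∈ C ∩ Metric.closedBall x₀ R := by
    refine ⟨hconv.add_smul_sub_mem hz.1 hy ⟨htpos.le, ht1⟩, ?_⟩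
    rw [mem_closedBall_iff_norm, add_sub_right_comm]
    refine (norm_add_le _ _).trans ?_
    rw [norm_smul, Real.norm_of_nonneg htpos.le]
    linarith
  have h := hzK _ hmem
  rw [add_sub_cancel_left, real_inner_smul_right] at h
  exact nonneg_of_mul_nonneg_right h htpos

/-- If `G + s P_M` is monotone and locally Lipschitz on the nonempty closed convex set `C`, then
`G + N_C + s P_M` is maximal monotone. -/
theorem isMaximalMonotone_elicitedMap [FiniteDimensional ℝ H] {C : Set H} (hne : C.Nonempty)
    (hcl : IsClosed C) (hconv : Convex ℝ C) {G : H → H} (hL : LocallyLipschitzOn C G)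
    (M : Submodule ℝ H) (s : ℝ)
    (hG : ∀ x ∈ C, ∀ y ∈ C,
      0 ≤ ⟪G x + s • M.starProjection x - (G y + s • M.starProjection y), x - y⟫_ℝ) :
    IsMaximalMonotone (elicitedMap G C M s) := by
  refine ⟨?_, fun x' y' hy' => ?_⟩
  · rintro x y _ ⟨v, ⟨hx, hv⟩, rfl⟩ _ ⟨w, ⟨hy, hw⟩, rfl⟩
    have h1 := hG x hx y hy
    have h2 := hv y hy
    have h3 := hw x hx
    simp only [inner_sub_left, inner_add_left, inner_sub_right] at h1 h2 h3 ⊢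
    linarith
  -- The variational inequality for `B` on `C` says `-B z ∈ N_C(z)`, that is, `x' + y' ∈ z + T z`.
  · let B : H → H := fun z => z + (G z + s • M.starProjection z) - (x' + y')
    have hB : ∀ x ∈ C, ∀ y ∈ C, ‖x - y‖ ^ 2 ≤ ⟪B x - B y, x - y⟫_ℝ := fun x hx y hy => by
      have h := hG x hx y hy
      have e : B x - B y =
          (x - y) + (G x + s • M.starProjection x - (G y + s • M.starProjection y)) := by
        simp only [B]; abel
      rw [e, inner_add_left, real_inner_self_eq_norm_sq]
      linarith
    have hBL : LocallyLipschitzOn C B := by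
      intro x hx
      obtain ⟨K, t, ht, hK⟩ := hL hx
      have h1 : LipschitzWith _ (fun z => z + (s • M.starProjection) z - (x' + y')) :=
        (LipschitzWith.id.add (s • M.starProjection).lipschitz).sub (LipschitzWith.const (x' + y'))
      have e : B = fun z => G z + (z + (s • M.starProjection) z - (x' + y')) := by
        funext z
        simp only [B, smul_apply]
        abel
      rw [e]
      exact ⟨_, t, ht, hK.add (h1.lipschitzOnWith (s := t))⟩
    obtain ⟨z, hz, hzC⟩ := exists_variationalInequality hne hcl hconv hBL hB
    have hT : x' + y' - z ∈ elicitedMap G C M s z := by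
      refine ⟨-B z, ⟨hz, fun y hy => ?_⟩, ?_⟩
      · rw [inner_neg_left]; linarith [hzC y hy]
      · simp only [B]; abel
    refine ⟨z, _, hT, ?_⟩
    have hne' : x' - z ≠ 0 := fun h => by
      obtain rfl := sub_eq_zero.1 h
      rw [add_sub_cancel_left] at hT
      exact hy' hT
    have e : y' - (x' + y' - z) = -(x' - z) := by abel
    rw [e, inner_neg_left, neg_lt_zero]
    exact real_inner_self_pos.2 hne'

/-- A lower bound on the quadratic forms of the derivative on a convex set bounds the increments. -/
theorem le_inner_sub_of_hasFDerivWithinAt {K : Set H} (hconv : Convex ℝ K) {f : H → H}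
    {D : H → H →L[ℝ] H} (hD : ∀ x ∈ K, HasFDerivWithinAt f (D x) K x) {x y : H} (hx : x ∈ K)
    (hy : y ∈ K) {c : ℝ} (hc : ∀ z ∈ K, c ≤ ⟪y - x, D z (y - x)⟫_ℝ) :
    c ≤ ⟪f y - f x, y - x⟫_ℝ := by
  have hline : ∀ t ∈ Set.Icc (0 : ℝ) 1, x + t • (y - x) ∈ K := fun t ht =>
    hconv.add_smul_sub_mem hx hy ht
  have hder : ∀ t ∈ Set.Icc (0 : ℝ) 1,
      HasDerivWithinAt (fun t : ℝ => ⟪y - x, f (x + t • (y - x))⟫_ℝ)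
        ⟪y - x, D (x + t • (y - x)) (y - x)⟫_ℝ (Set.Icc 0 1) t := fun t ht => by
    have h1 : HasDerivWithinAt (fun t : ℝ => x + t • (y - x)) (y - x) (Set.Icc 0 1) t := by
      simpa using (((hasDerivAt_id t).smul_const (y - x)).const_add x).hasDerivWithinAt
    exact ((innerSL ℝ (y - x)).hasFDerivAt.comp_hasDerivWithinAt t
      ((hD _ (hline t ht)).comp_hasDerivWithinAt t h1 hline))
  -- At interior times the derivative relative to `[0, 1]` is a full derivative, so derivatives
  -- relative to `K` suffice.
  obtain ⟨t, ht, h⟩ := exists_hasDerivAt_eq_slope _ _ zero_lt_one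
    (fun t ht => (hder t ht).continuousWithinAt)
    (fun t ht => (hder t (Set.Ioo_subset_Icc_self ht)).hasDerivAt (Icc_mem_nhds ht.1 ht.2))
  have h2 := hc _ (hline t (Set.Ioo_subset_Icc_self ht))
  rw [h] at h2
  rw [real_inner_comm, inner_sub_right]
  simpa using h2

theorem inner_starProjection_self (M : Submodule ℝ H) [M.HasOrthogonalProjection] (x : H) :
    ⟪M.starProjection x, x⟫_ℝ = ‖M.starProjection x‖ ^ 2 := by
  rw [← real_inner_self_eq_norm_sq, ← M.inner_starProjection_left_eq_right,
    Submodule.starProjection_eq_self_iff.2 (M.starProjection_apply_mem x)]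

end VariationalInequality

/-! ### Nonanticipativity and the constraint set -/

variable {N : ℕ} {Ξ : Fin N → Type*} [∀ k, Fintype (Ξ k)] (P : ScenarioLaw Ξ)

theorem LSpace.inner_def {n : Fin N → ℕ} (x w : LSpace P n) :
    ⟪x, w⟫_ℝ = ∑ ξ, P.prob ξ * ⟪x ξ, w ξ⟫_ℝ := rfl

/-- Test `x` against the difference of point masses at `ξ` and `ξ'`, each weighted by the inverse
probability. It lies in `𝓜ₙ`, and pairing with it reads off `x_k(ξ) - x_k(ξ')` coordinatewise. -/
theorem orthogonal_multiplierSpace_le (n : Fin N → ℕ) :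
    (multiplierSpace P n)ᗮ ≤ nonanticipative P n := by
  classical
  intro x hx k ξ ξ' hξ i
  let a : Scenario Ξ → ℝ := fun η =>
    (if η = ξ then (P.prob ξ)⁻¹ else 0) - if η = ξ' then (P.prob ξ')⁻¹ else 0
  have ha : ∀ η, P.prob η * a η = (if η = ξ then 1 else 0) - if η = ξ' then 1 else 0 := by
    intro η
    have h := (P.prob_pos η).ne'
    simp only [a, mul_sub]
    congr 1 <;> split_ifs with h' <;> first | (subst h'; exact mul_inv_cancel₀ h) | simp
  let w : LSpace P n := fun η => EuclideanSpace.single ⟨k, i⟩ (a η)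
  have hw : w ∈ multiplierSpace P n := by
    intro l j η
    unfold condExpBefore
    by_cases hl : (⟨l, j⟩ : Σ k, Fin (n k)) = ⟨k, i⟩
    · obtain ⟨rfl, hj⟩ := Sigma.mk.inj_iff.1 hl
      obtain rfl := eq_of_heq hj
      -- Each conditioning event before stage `l` contains both `ξ` and `ξ'` or neither, so the two
      -- unit masses cancel.
      have hiff : (∀ m < l, ξ m = η m) ↔ ∀ m < l, ξ' m = η m :=
        forall₂_congr fun m hm => by rw [hξ m hm]
      have e : ∀ ξ₁, w ξ₁ ⟨l, j⟩ = a ξ₁ := fun ξ₁ => by simp [w]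
      simp only [e, ha, Finset.sum_sub_distrib, Finset.sum_ite_eq', Finset.mem_filter,
        Finset.mem_univ, true_and, hiff, sub_self, zero_div]
    · have e : ∀ ξ₁, w ξ₁ ⟨l, j⟩ = 0 := fun ξ₁ => by simp [w, hl]
      simp only [e, mul_zero, Finset.sum_const_zero, zero_div]
  have h := (Submodule.mem_orthogonal _ _).1 hx w hw
  rw [LSpace.inner_def] at h
  have e : ∀ η, P.prob η * ⟪w η, x η⟫_ℝ =
      ((if η = ξ then 1 else 0) - if η = ξ' then 1 else 0) * x η ⟨k, i⟩ := fun η => by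
    rw [← ha, mul_assoc]
    simp [w, EuclideanSpace.inner_single_left]
  simp only [e, sub_mul, ite_mul, one_mul, zero_mul, Finset.sum_sub_distrib, Finset.sum_ite_eq',
    Finset.mem_univ, if_true] at h
  exact sub_eq_zero.1 h

variable {n : Fin N → ℕ}

theorem phi_svMap (F : Decision n → Scenario Ξ → Decision n) (x : LSpace P n) :
    phi P n (svMap P F x) = hatMap P F (phi P n x) := by
  ext c
  have h : (1 / √(P.prob c.1)) • block (phi P n x) c.1 = x c.1 := by
    rw [one_div]
    exact congrFun ((phi P n).symm_apply_apply x) c.1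
  change √(P.prob c.1) * F (x c.1) c.1 c.2 =
    √(P.prob c.1) * F ((1 / √(P.prob c.1)) • block (phi P n x) c.1) c.1 c.2
  rw [h]

theorem continuous_eval (ξ : Scenario Ξ) : Continuous fun x : LSpace P n => x ξ :=
  LinearMap.continuous_of_finiteDimensional
    (⟨⟨fun x => x ξ, fun _ _ => rfl⟩, fun _ _ => rfl⟩ : LSpace P n →ₗ[ℝ] Decision n)

theorem isClosed_constraintSet {C : Scenario Ξ → Set (Decision n)} (hC : ∀ ξ, IsClosed (C ξ)) :
    IsClosed (constraintSet P C) := by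
  have h : constraintSet P C = ⋂ ξ, (fun x : LSpace P n => x ξ) ⁻¹' C ξ := by
    ext x; simp [constraintSet]
  rw [h]
  exact isClosed_iInter fun ξ => (hC ξ).preimage (continuous_eval P ξ)

theorem convex_constraintSet {C : Scenario Ξ → Set (Decision n)} (hC : ∀ ξ, Convex ℝ (C ξ)) :
    Convex ℝ (constraintSet P C) :=
  fun _ hx _ hy _ _ ha hb hab ξ => hC ξ (hx ξ) (hy ξ) ha hb hab

/-! ### Bounds on the quadratic form of the Jacobian -/

/-- `A` need not be symmetric: the two cross terms add up to `⟪u, (A + Aᵀ) w⟫`, and the projectors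
fix `u` and `w`. -/
theorem two_mul_beta_mul_le (A : Stacked Ξ n →L[ℝ] Stacked Ξ n) {u w : Stacked Ξ n}
    (hu : u ∈ phiN P n) (hw : w ∈ phiM P n) :
    |⟪u, A w⟫_ℝ + ⟪w, A u⟫_ℝ| ≤ 2 * beta P A * ‖u‖ * ‖w‖ := by
  set T := (phiN P n).starProjection ∘L (A + ContinuousLinearMap.adjoint A) ∘L
    (phiM P n).starProjection with hT
  have e : ⟪u, A w⟫_ℝ + ⟪w, A u⟫_ℝ = ⟪u, T w⟫_ℝ := by
    simp only [hT, ContinuousLinearMap.comp_apply]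
    rw [← Submodule.inner_starProjection_left_eq_right, Submodule.starProjection_eq_self_iff.2 hu,
      Submodule.starProjection_eq_self_iff.2 hw, add_apply, inner_add_right,
      ContinuousLinearMap.adjoint_inner_right, real_inner_comm w (A u)]
  have h : 2 * beta P A = ‖T‖ := by rw [beta]; ring
  rw [e, h]
  calc |⟪u, T w⟫_ℝ| ≤ ‖u‖ * ‖T w‖ := abs_real_inner_le_norm _ _
    _ ≤ ‖u‖ * (‖T‖ * ‖w‖) := by gcongr; exact T.le_opNorm w
    _ = ‖T‖ * ‖u‖ * ‖w‖ := by ring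

theorem abs_inner_le_gamma_mul (A : Stacked Ξ n →L[ℝ] Stacked Ξ n) {w : Stacked Ξ n}
    (hw : w ∈ phiM P n) : |⟪w, A w⟫_ℝ| ≤ gamma P A * ‖w‖ ^ 2 := by
  set T := (phiM P n).starProjection ∘L A ∘L (phiM P n).starProjection with hT
  have e : ⟪w, A w⟫_ℝ = ⟪w, T w⟫_ℝ := by
    simp only [hT, ContinuousLinearMap.comp_apply]
    rw [← Submodule.inner_starProjection_left_eq_right, Submodule.starProjection_eq_self_iff.2 hw]
  rw [e]
  calc |⟪w, T w⟫_ℝ| ≤ ‖w‖ * ‖T w‖ := abs_real_inner_le_norm _ _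
    _ ≤ ‖w‖ * (‖T‖ * ‖w‖) := by gcongr; exact T.le_opNorm w
    _ = gamma P A * ‖w‖ ^ 2 := by rw [gamma]; ring

theorem quadratic_nonneg_of_ofReal_div_lt {a b g s : ℝ} (ha : 0 ≤ a) (hg : 0 ≤ g)
    (h : ENNReal.ofReal (b ^ 2) / ENNReal.ofReal a + ENNReal.ofReal g < ENNReal.ofReal s)
    (u w : ℝ) : 0 ≤ a * u ^ 2 - 2 * b * u * w + (s - g) * w ^ 2 := by
  rcases ha.eq_or_lt with rfl | ha
  · have hb : b = 0 := by
      -- When `a = 0`, a nonzero `b` would make the quotient infinite.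
      by_contra hb
      have hb2 : ENNReal.ofReal (b ^ 2) ≠ 0 := by
        rw [Ne, ENNReal.ofReal_eq_zero, not_le]; positivity
      rw [ENNReal.ofReal_zero, ENNReal.div_zero hb2, top_add] at h
      exact not_top_lt h
    subst hb
    have hgs := (ENNReal.ofReal_lt_ofReal_iff_of_nonneg hg).1 (lt_of_le_of_lt le_add_self h)
    nlinarith [mul_nonneg (sub_nonneg.2 hgs.le) (sq_nonneg w)]
  · rw [← ENNReal.ofReal_div_of_pos ha, ← ENNReal.ofReal_add (by positivity) hg,
      ENNReal.ofReal_lt_ofReal_iff_of_nonneg (by positivity)] at h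
    have e : a * u ^ 2 - 2 * b * u * w + b ^ 2 / a * w ^ 2 = (a * u - b * w) ^ 2 / a := by
      field_simp
      ring
    have h1 : 0 ≤ (a * u - b * w) ^ 2 / a := by positivity
    nlinarith [mul_nonneg (sub_nonneg.2 h.le) (sq_nonneg w)]

/-- The quadratic form of a Jacobian satisfying the criterion is bounded below by `-s ‖P_M d‖²`. -/
theorem neg_mul_norm_sq_le_inner {A : Stacked Ξ n →L[ℝ] Stacked Ξ n} {a s : ℝ} (ha : 0 ≤ a)
    (hA : ∀ y ∈ phiN P n, a * ‖y‖ ^ 2 ≤ ⟪y, A y⟫_ℝ)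
    (h : ENNReal.ofReal (beta P A ^ 2) / ENNReal.ofReal a + ENNReal.ofReal (gamma P A) <
      ENNReal.ofReal s) (d : LSpace P n) :
    -(s * ‖(multiplierSpace P n).starProjection d‖ ^ 2) ≤ ⟪phi P n d, A (phi P n d)⟫_ℝ := by
  set w := (multiplierSpace P n).starProjection d with hw
  have hwM : phi P n w ∈ phiM P n :=
    ⟨w, Submodule.starProjection_apply_mem _ d, rfl⟩
  have huN : phi P n (d - w) ∈ phiN P n :=
    ⟨d - w, orthogonal_multiplierSpace_le P n (Submodule.sub_starProjection_mem_orthogonal d), rfl⟩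
  have e : phi P n d = phi P n (d - w) + phi P n w := by rw [← map_add, sub_add_cancel]
  have hb := neg_le_of_abs_le (two_mul_beta_mul_le P A huN hwM)
  have hg := neg_le_of_abs_le (abs_inner_le_gamma_mul P A hwM)
  have hq := quadratic_nonneg_of_ofReal_div_lt ha (g := gamma P A) (norm_nonneg _) h
    ‖phi P n (d - w)‖ ‖phi P n w‖
  have hN := hA _ huN
  rw [e, map_add, inner_add_left, inner_add_right, inner_add_right, ← (phi P n).norm_map w]
  linarith

end MultistageSVI

theorem mainTheorem4 {N : ℕ} {Ξ : Fin N → Type*} [∀ k, Fintype (Ξ k)]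
    (P : MultistageSVI.ScenarioLaw Ξ) (n : Fin N → ℕ)
    (C : MultistageSVI.Scenario Ξ → Set (MultistageSVI.Decision n))
    (hCne : ∀ ξ, (C ξ).Nonempty) (hCcl : ∀ ξ, IsClosed (C ξ)) (hCcv : ∀ ξ, Convex ℝ (C ξ))
    (F : MultistageSVI.Decision n → MultistageSVI.Scenario Ξ → MultistageSVI.Decision n)
    -- `𝓕` is continuously differentiable and pseudomonotone on `𝓒`
    (hC1 : ContDiffOn ℝ 1 (MultistageSVI.svMap P F) (MultistageSVI.constraintSet P C))
    (hpm : MultistageSVI.PseudomonotoneOn (MultistageSVI.svMap P F)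
      (MultistageSVI.constraintSet P C))
    -- `D x` is the Jacobian of `F̂` at `x`, relative to `φ(𝓒)`
    (D : MultistageSVI.Stacked Ξ n →
      MultistageSVI.Stacked Ξ n →L[ℝ] MultistageSVI.Stacked Ξ n)
    (hD : ∀ x ∈ MultistageSVI.phi P n '' MultistageSVI.constraintSet P C,
      HasFDerivWithinAt (MultistageSVI.hatMap P F) (D x)
        (MultistageSVI.phi P n '' MultistageSVI.constraintSet P C) x)
    (α : MultistageSVI.Stacked Ξ n → ℝ)
    (hα_nonneg : ∀ x ∈ MultistageSVI.phi P n '' MultistageSVI.constraintSet P C, 0 ≤ α x)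
    (hα : ∀ x ∈ MultistageSVI.phi P n '' MultistageSVI.constraintSet P C,
      ∀ y ∈ MultistageSVI.phiN P n, α x * ‖y‖ ^ 2 ≤ inner ℝ y (D x y))
    (he : MultistageSVI.elicitationBound P D α
      (MultistageSVI.phi P n '' MultistageSVI.constraintSet P C) < ⊤) :
    ∀ s : ℝ,
      MultistageSVI.elicitationBound P D α
          (MultistageSVI.phi P n '' MultistageSVI.constraintSet P C) < ENNReal.ofReal s →
        MultistageSVI.GloballyElicitedAt (MultistageSVI.svMap P F)
          (MultistageSVI.constraintSet P C) (MultistageSVI.multiplierSpace P n) s := by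
  intro s hs
  have hne : (MultistageSVI.constraintSet P C).Nonempty :=
    ⟨fun ξ => (hCne ξ).some, fun ξ => (hCne ξ).some_mem⟩
  have hconv := MultistageSVI.convex_constraintSet P hCcv
  have himage : Convex ℝ (MultistageSVI.phi P n '' MultistageSVI.constraintSet P C) :=
    hconv.linear_image (MultistageSVI.phi P n).toLinearEquiv.toLinearMap
  refine ⟨ENNReal.ofReal_pos.1 (lt_of_le_of_lt zero_le hs),
    MultistageSVI.isMaximalMonotone_elicitedMap
      hne (MultistageSVI.isClosed_constraintSet P hCcl) hconv
      (fun x hx => (hC1 x hx).exists_lipschitzOnWith hconv) _ s fun x hx y hy => ?_⟩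
  have hmono := MultistageSVI.le_inner_sub_of_hasFDerivWithinAt himage hD
    (Set.mem_image_of_mem _ hy) (Set.mem_image_of_mem _ hx)
    (c := -(s * ‖(MultistageSVI.multiplierSpace P n).starProjection (x - y)‖ ^ 2))
    fun z hz => by
      rw [← map_sub]
      exact MultistageSVI.neg_mul_norm_sq_le_inner P (hα_nonneg z hz) (hα z hz)
        (lt_of_le_of_lt (le_iSup₂_of_le z hz le_rfl) hs) _
  -- Since `φ ∘ 𝓕 = F̂ ∘ φ` and `φ` is an isometry, the bound transfers back to `𝓛ₙ`.
  rw [← MultistageSVI.phi_svMap, ← MultistageSVI.phi_svMap, ← map_sub, ← map_sub,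
    LinearIsometryEquiv.inner_map_map] at hmono
  rw [add_sub_add_comm, ← smul_sub, ← map_sub, inner_add_left, real_inner_smul_left,
    MultistageSVI.inner_starProjection_self]
  linarith
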